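/- Theorem 3. Let $n$ and $k$ be integers with $2\le k\le n-1$. Put $$M_k=\int_0^1\frac{t^{k-1}}{\sqrt{1-t^{2k-2}}}\,dt,$$ let the Archimedean scaling function $f_k:[0,M_k]\to[0,1]$ be the inverse of the bijection $[0,1]\to[0,M_k]$, $y\mapsto\int_0^y\frac{t^{k-1}}{\sqrt{1-t^{2k-2}}}\,dt$, let $B\subset\mathbb{R}^{n-k}$ be the closed ball of radius $M_k$ centred at the origin, and let $\omega(x'')=\operatorname{dist}(x'',\partial B)$ for $x''\in B$. Let $$\mathscr{A}_k^{n-1}=\{(x'',x')\in B\times\mathbb{R}^k:\ \|x'\|^2=[f_k(\omega(x''))]^2\}\subset\mathbb{R}^{n-k}\times\mathbb{R}^k=\mathbb{R}^n$$ be the Archimedean spherical array of codimension $k$, normalized so that its constant of proportionality is the volume of the unit sphere $S^{k-1}$. For $r\ge 1$, call $S\subset\mathbb{R}^n$ a hypersurface of class $C^r$ (respectively, real analytic) if every $p\in S$ has an open neighbourhood $U$ on which there is a $C^r$ (respectively, real analytic) function $F:U\to\mathbb{R}$ with $dF(p)\ne0$ and $S\cap U=\{x\in U: F(x)=0\}$.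 Then: (i) if $k$ is even, $\mathscr{A}_k^{n-1}$ is a real analytic hypersurface; (ii) if $k$ is odd, $\mathscr{A}_k^{n-1}$ is a hypersurface of class $C^{k-1}$, and this is its exact degree of smoothness: it is not a hypersurface of class $C^k$. -/

import Mathlib

open scoped ContDiff

/-- The function `y ↦ ∫₀^y t^(k-1) / √(1 - t^(2k-2)) dt` on `[0, 1]`, the inverse of the
codimension `k` Archimedean scaling function. -/
noncomputable def scalingIntegral (k : ℕ) (y : ℝ) : ℝ :=
  ∫ t in (0 : ℝ)..y, t ^ (k - 1) / Real.sqrt (1 - t ^ (2 * k - 2))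

/-- The number `M_k = ∫₀^1 t^(k-1) / √(1 - t^(2k-2)) dt`. -/
noncomputable def archimedeanRadius (k : ℕ) : ℝ := scalingIntegral k 1

/-- The codimension `k` Archimedean scaling function `f_k : [0, M_k] → [0, 1]`, the inverse of the
bijection `scalingIntegral k : [0, 1] → [0, M_k]`. Its values outside `[0, M_k]` are irrelevant. -/
noncomputable def archimedeanScaling (k : ℕ) : ℝ → ℝ :=
  Function.invFunOn (scalingIntegral k) (Set.Icc 0 1)

/-- The spherical array `Ω ×_f S^(k-1)` in `ℝ^m × ℝ^k` (with the Euclidean structure), with base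
`Ω ⊆ ℝ^m` and warping function `f`: all `(x'', x')` with `x'' ∈ Ω` and `‖x'‖² = f(x'')²`. -/
def sphericalArray (m k : ℕ) (Ω : Set (EuclideanSpace ℝ (Fin m)))
    (f : EuclideanSpace ℝ (Fin m) → ℝ) :
    Set (WithLp 2 (EuclideanSpace ℝ (Fin m) × EuclideanSpace ℝ (Fin k))) :=
  {p | p.fst ∈ Ω ∧ ‖p.snd‖ ^ 2 = f p.fst ^ 2}

/-- The base of the Archimedean spherical array: the closed ball of radius `M_k` in `ℝ^m`. -/
noncomputable def archimedeanBase (m k : ℕ) : Set (EuclideanSpace ℝ (Fin m)) :=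
  Metric.closedBall 0 (archimedeanRadius k)

/-- The Archimedean spherical array `𝒜_k^(n-1)` in `ℝⁿ = ℝ^(n-k) × ℝ^k`: the spherical array over
the ball of radius `M_k` with warping function the composition of `f_k` with the distance to the
boundary of the ball. -/
noncomputable def archimedeanSphericalArray (n k : ℕ) :
    Set (WithLp 2 (EuclideanSpace ℝ (Fin (n - k)) × EuclideanSpace ℝ (Fin k))) :=
  sphericalArray (n - k) k (archimedeanBase (n - k) k) fun x =>
    archimedeanScaling k (Metric.infDist x (frontier (archimedeanBase (n - k) k)))

/-- `S` is an embedded hypersurface of class `C^r` (`1 ≤ r`; `r = ω` means real analytic): near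
each of its points it is the zero set of a `C^r` real function whose derivative is nonzero there. -/
def IsHypersurfaceOfClass {E : Type*} [NormedAddCommGroup E] [NormedSpace ℝ E]
    (r : WithTop ℕ∞) (S : Set E) : Prop :=
  ∀ p ∈ S, ∃ U : Set E, IsOpen U ∧ p ∈ U ∧ ∃ F : E → ℝ,
    ContDiffOn ℝ r F U ∧ fderiv ℝ F p ≠ 0 ∧ S ∩ U = {x ∈ U | F x = 0}

/-! Write `G` for `scalingIntegral k` and `M` for `archimedeanRadius k`. Undoing the inverse
function turns the array into `‖x'‖ ≤ 1`, `‖x''‖ = M - G ‖x'‖`, that is, `‖x''‖² = (M - G ‖x'‖)²`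
over the unit ball.

Where `‖x'‖ < 1`, `x''` is nonzero, so this equation is regular, and only the smoothness of `G ‖x'‖`
matters. As `G y = y ^ k * H (y ^ 2)` near `0` with `H` analytic
(`exists_scalingIntegral_eq_pow_mul`), that is governed by `‖x'‖ ^ k`: a polynomial for even `k`,
and `C^(k-1)` in general by homogeneity (`contDiff_of_homogeneous`). Where `‖x'‖ = 1`, `G` has a
square root singularity, but `(M - G y)² = (1 - y) * A (1 - y) ^ 2` is analytic with a simple zero
(`exists_sq_archimedeanRadius_sub`), so the equation is again regular.

Conversely, let `F` be a `C^k` defining function at `(M e, 0)` with `e` a unit vector. Curves in the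
array show that `dF` kills every direction but the radial one (`fderiv_radial_ne_zero`). The
implicit function theorem in a plane then makes `G |y| = |y| ^ k * H (y ^ 2)` of class `C^k`; as `H
0 ≠ 0`, so is `|y| ^ k`, which is false for odd `k`. -/

open Filter Topology Set

/-! ### Analytic solutions of first order equations -/

/-- The Euler equation `A + c u A' = b` has an analytic solution when `b` is analytic. -/
theorem AnalyticAt.exists_add_mul_deriv_eq {b : ℝ → ℝ} (hb : AnalyticAt ℝ b 0) {c : ℝ}
    (hc : 0 ≤ c) :
    ∃ A : ℝ → ℝ, AnalyticAt ℝ A 0 ∧ ∀ᶠ u in 𝓝 0, A u + c * u * deriv A u = b u := by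
  obtain ⟨p, r, hp⟩ := hb
  have hpos (n : ℕ) : 0 < 1 + c * n := by positivity
  -- The operator `u d/du` multiplies the `n`th Taylor coefficient by `n`, so the equation is solved
  -- by dividing by `1 + c n ≥ 1`, which does not shrink the radius.
  let q : FormalMultilinearSeries ℝ ℝ ℝ := fun n => (1 + c * n)⁻¹ • p n
  have hq : r ≤ q.radius := by
    refine hp.r_le.trans (FormalMultilinearSeries.radius_le_of_le fun n => ?_)
    rw [norm_smul]
    refine mul_le_of_le_one_left (norm_nonneg _) ?_
    rw [norm_inv, Real.norm_of_nonneg (hpos n).le]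
    exact inv_le_one_of_one_le₀ (by nlinarith [hpos n, mul_nonneg hc (Nat.cast_nonneg (α := ℝ) n)])
  have hA := (q.hasFPowerSeriesOnBall (hp.r_pos.trans_le hq)).mono hp.r_pos hq
  refine ⟨q.sum, hA.analyticAt, ?_⟩
  filter_upwards [Metric.eball_mem_nhds 0 hp.r_pos] with u hu
  have h1 := hA.hasSum hu
  have h2 := (ContinuousLinearMap.apply ℝ ℝ u).hasSum (hA.fderiv.hasSum hu)
  have h3 := hp.hasSum hu
  simp only [zero_add, ContinuousLinearMap.apply_apply] at h1 h2 h3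
  simp only [FormalMultilinearSeries.derivSeries_apply_diag] at h2
  have h4 : HasSum (fun n : ℕ => n • q n fun _ => u) (fderiv ℝ q.sum u u) := by
    -- The series of `u A'(u)` is indexed from the linear term; the missing term `n = 0` vanishes.
    rw [← hasSum_nat_add_iff' 1]
    simpa using h2
  have h5 := h1.add (h4.mul_left c)
  have h6 : (fun n : ℕ => (q n fun _ => u) + c * (n • q n fun _ => u)) =
      fun n => p n fun _ => u := by
    ext n
    have := (hpos n).ne'
    simp only [q, smul_apply, smul_eq_mul, nsmul_eq_mul]
    field_simp
  rw [h6] at h5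
  have h7 : fderiv ℝ q.sum u u = u * deriv q.sum u := by
    rw [fderiv_eq_smul_deriv, smul_eq_mul]
  rw [← h5.unique h3, h7]
  ring

/-- An analytic function of one real variable has an analytic primitive. -/
theorem AnalyticAt.exists_hasDerivAt {b : ℝ → ℝ} {x : ℝ} (hb : AnalyticAt ℝ b x) :
    ∃ B : ℝ → ℝ, AnalyticAt ℝ B x ∧ ∀ᶠ y in 𝓝 x, HasDerivAt B (b y) y := by
  have hb' : AnalyticAt ℝ (fun u => b (x + u)) 0 :=
    AnalyticAt.fun_comp (by simpa using hb) (by fun_prop)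
  obtain ⟨A, hA, h⟩ := hb'.exists_add_mul_deriv_eq zero_le_one
  have hsub : Tendsto (fun y => y - x) (𝓝 x) (𝓝 0) := by
    simpa using (continuous_sub_right x).tendsto x
  have hA' : AnalyticAt ℝ (fun y => A (y - x)) x :=
    AnalyticAt.fun_comp (by simpa using hA) (by fun_prop)
  -- With `c = 1` the left side of the Euler equation is `(u A)'`.
  refine ⟨fun y => (y - x) * A (y - x), (analyticAt_id.sub analyticAt_const).mul hA', ?_⟩
  filter_upwards [hsub.eventually h, hsub.eventually hA.eventually_analyticAt] with y h1 h2
  have h3 : HasDerivAt (fun y => A (y - x)) (deriv A (y - x)) y :=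
    (h2.differentiableAt.hasDerivAt).comp_sub_const y x
  convert! ((hasDerivAt_id y).sub_const x).mul h3 using 1
  simp only [id, add_sub_cancel] at h1 ⊢
  linarith

/-! ### Smoothness of powers of the norm -/

/-- A function smooth off the origin and positively homogeneous of degree `d + 1` is `C^d`. -/
theorem contDiff_of_homogeneous {E : Type} [NormedAddCommGroup E] [NormedSpace ℝ E]
    [FiniteDimensional ℝ E] (d : ℕ) : ∀ {F : Type} [NormedAddCommGroup F] [NormedSpace ℝ F]
    {f : E → F}, ContDiffOn ℝ ∞ f {0}ᶜ → f 0 = 0 →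
    (∀ c : ℝ, 0 < c → ∀ x, f (c • x) = c ^ (d + 1) • f x) → ContDiff ℝ d f := by
  have bound {F : Type} [NormedAddCommGroup F] [NormedSpace ℝ F] {f : E → F} (d : ℕ)
      (hf : ContDiffOn ℝ ∞ f {0}ᶜ) (h0 : f 0 = 0)
      (hh : ∀ c : ℝ, 0 < c → ∀ x, f (c • x) = c ^ (d + 1) • f x) :
      ∃ C, ∀ x, ‖f x‖ ≤ C * ‖x‖ ^ (d + 1) := by
    have hs : Metric.sphere (0 : E) 1 ⊆ {0}ᶜ := fun x hx => by
      rintro rfl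
      simp at hx
    obtain ⟨C, hC⟩ := (isCompact_sphere (0 : E) 1).exists_bound_of_continuousOn
      (hf.continuousOn.mono hs)
    refine ⟨C, fun x => ?_⟩
    rcases eq_or_ne x 0 with rfl | hx
    · simp [h0]
    · have hx' : 0 < ‖x‖ := norm_pos_iff.2 hx
      have h1 := hC (‖x‖⁻¹ • x) (by simp [norm_smul, hx'.ne'])
      have h2 := hh ‖x‖ hx' (‖x‖⁻¹ • x)
      rw [smul_inv_smul₀ hx'.ne'] at h2
      rw [h2, norm_smul, norm_pow, norm_norm, mul_comm]
      gcongr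
  -- The target must vary in the induction: the derivative takes values in `E →L[ℝ] F` and is
  -- homogeneous of one degree less.
  induction d with
  | zero =>
    intro F _ _ f hf h0 hh
    rw [Nat.cast_zero, contDiff_zero, continuous_iff_continuousAt]
    intro x
    rcases eq_or_ne x 0 with rfl | hx
    · obtain ⟨C, hC⟩ := bound 0 hf h0 hh
      rw [ContinuousAt, h0]
      refine squeeze_zero_norm hC ?_
      have : Continuous fun x : E => C * ‖x‖ ^ (0 + 1) := by fun_prop
      simpa using this.tendsto 0
    · exact (hf.contDiffAt (isOpen_compl_singleton.mem_nhds hx)).continuousAt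
  | succ d ih =>
    intro F _ _ f hf h0 hh
    have hd0 : HasFDerivAt f (0 : E →L[ℝ] F) 0 := by
      obtain ⟨C, hC⟩ := bound (d + 1) hf h0 hh
      rw [hasFDerivAt_iff_isLittleO_nhds_zero]
      simp only [zero_add, h0, sub_zero, zero_apply]
      refine (Asymptotics.IsBigO.of_bound C (g := fun x : E => ‖x‖ ^ (d + 1 + 1))
        (Eventually.of_forall fun x => ?_)).trans_isLittleO ?_
      · simpa using hC x
      · have := Asymptotics.isLittleO_pow_pow (𝕜 := ℝ) (m := 1) (n := d + 1 + 1) (by omega)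
        have := this.comp_tendsto (tendsto_norm_zero (E := E))
        exact Asymptotics.IsLittleO.of_norm_right (by simpa [Function.comp_def] using this)
    have hd (x : E) : DifferentiableAt ℝ f x := by
      rcases eq_or_ne x 0 with rfl | hx
      · exact hd0.differentiableAt
      · exact (hf.contDiffAt (isOpen_compl_singleton.mem_nhds hx)).differentiableAt (by simp)
    have : ((d + 1 : ℕ) : WithTop ℕ∞) = d + 1 := by simp
    rw [this, contDiff_succ_iff_fderiv]
    refine ⟨hd, by simp, ih ?_ hd0.fderiv ?_⟩
    · exact hf.fderiv_of_isOpen isOpen_compl_singleton (by simp)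
    · intro c hc x
      have h1 : HasFDerivAt (fun y => f (c • y)) ((fderiv ℝ f (c • x)).comp
          (c • ContinuousLinearMap.id ℝ E)) x :=
        (hd (c • x)).hasFDerivAt.comp x ((hasFDerivAt_id x).const_smul c)
      have h2 : HasFDerivAt (fun y => f (c • y)) (c ^ (d + 1 + 1) • fderiv ℝ f x) x := by
        simp only [hh c hc]
        exact (hd x).hasFDerivAt.const_smul _
      have h3 := h1.unique h2
      ext v
      have h4 := congrArg (fun T => c⁻¹ • T v) h3
      simpa [smul_smul, pow_succ, inv_mul_cancel₀ hc.ne', hc.ne', mul_comm, mul_left_comm] using h4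

theorem contDiff_norm_pow_succ {E : Type} [NormedAddCommGroup E] [InnerProductSpace ℝ E]
    [FiniteDimensional ℝ E] (d : ℕ) : ContDiff ℝ d fun x : E => ‖x‖ ^ (d + 1) := by
  refine contDiff_of_homogeneous d ?_ (by simp) fun c hc x => ?_
  · intro x hx
    exact ((contDiffAt_norm ℝ hx).pow _).contDiffWithinAt
  · simp [norm_smul, mul_pow, abs_of_pos hc]

/-- For odd `k` the function `|y| ^ k` is not `C^k` at the origin. -/
theorem not_contDiffAt_abs_pow {k : ℕ} (hk : Odd k) : ¬ ContDiffAt ℝ k (fun y : ℝ => |y| ^ k) 0 := by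
  intro h
  have hcont : ContinuousAt (iteratedDeriv k fun y : ℝ => |y| ^ k) 0 := by
    have h1 := (h.iteratedFDeriv_right (i := k) (m := 0) (by simp)).continuousAt
    simp only [iteratedDeriv_eq_equiv_comp]
    exact (LinearIsometryEquiv.continuous _).continuousAt.comp h1
  -- A derivative of odd order of an even function is odd, so it vanishes at `0`; to the right of
  -- `0` it equals `k!`.
  have h0 : iteratedDeriv k (fun y : ℝ => |y| ^ k) 0 = 0 := by
    have := iteratedDeriv_comp_neg k (fun y : ℝ => |y| ^ k) 0
    simp only [abs_neg, hk.neg_one_pow, neg_zero] at this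
    simp only [smul_eq_mul] at this
    linarith
  have h1 : ∀ y : ℝ, 0 < y → iteratedDeriv k (fun y : ℝ => |y| ^ k) y = k.factorial := by
    intro y hy
    have : (fun y : ℝ => |y| ^ k) =ᶠ[𝓝 y] fun y => y ^ k := by
      filter_upwards [lt_mem_nhds hy] with z hz
      rw [abs_of_pos hz]
    rw [this.iteratedDeriv_eq]
    simp [Nat.descFactorial_self]
  have h2 : Tendsto (iteratedDeriv k fun y : ℝ => |y| ^ k) (𝓝[>] 0) (𝓝 0) := by
    have := hcont.tendsto.mono_left (nhdsWithin_le_nhds (s := Ioi 0))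
    rwa [h0] at this
  have h3 : Tendsto (iteratedDeriv k fun y : ℝ => |y| ^ k) (𝓝[>] 0) (𝓝 (k.factorial : ℝ)) := by
    refine tendsto_const_nhds.congr' ?_
    filter_upwards [self_mem_nhdsWithin] with y hy using (h1 y hy).symm
  exact (Nat.cast_ne_zero.2 k.factorial_ne_zero) (tendsto_nhds_unique h3 h2)

/-! ### Primitives and analyticity -/

theorem eventually_sub_eq_of_hasDerivAt {f g b : ℝ → ℝ} {x : ℝ}
    (hf : ∀ᶠ y in 𝓝 x, HasDerivAt f (b y) y) (hg : ∀ᶠ y in 𝓝 x, HasDerivAt g (b y) y) :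
    ∀ᶠ y in 𝓝 x, f y = g y + (f x - g x) := by
  obtain ⟨ε, hε, h⟩ := Metric.eventually_nhds_iff_ball.1 (hf.and hg)
  have hx : x ∈ Metric.ball x ε := Metric.mem_ball_self hε
  filter_upwards [Metric.ball_mem_nhds x hε] with y hy
  have hd (z) (hz : z ∈ Metric.ball x ε) : HasDerivAt (fun z => f z - g z) 0 z := by
    convert! (h z hz).1.sub (h z hz).2 using 1
    simp
  have := Metric.isOpen_ball.is_const_of_deriv_eq_zero (convex_ball x ε).isPreconnected
    (fun z hz => (hd z hz).differentiableAt.differentiableWithinAt)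
    (fun z hz => (hd z hz).deriv) hy hx
  linarith

theorem AnalyticAt.of_hasDerivAt {f b : ℝ → ℝ} {x : ℝ} (hb : AnalyticAt ℝ b x)
    (hf : ∀ᶠ y in 𝓝 x, HasDerivAt f (b y) y) : AnalyticAt ℝ f x := by
  obtain ⟨B, hB, h⟩ := hb.exists_hasDerivAt
  have := eventually_sub_eq_of_hasDerivAt hf h
  exact (hB.add analyticAt_const).congr (EventuallyEq.symm this)

theorem contDiffAt_omega_iff_analyticAt {E F : Type*} [NormedAddCommGroup E] [NormedSpace ℝ E]
    [NormedAddCommGroup F] [NormedSpace ℝ F] [CompleteSpace F] {f : E → F} {x : E} :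
    ContDiffAt ℝ ω f x ↔ AnalyticAt ℝ f x := by
  rw [← contDiffWithinAt_univ, contDiffWithinAt_omega_iff_analyticWithinAt,
    analyticWithinAt_univ]

/-! ### The scaling integral and its inverse -/

/-- The integrand `t^(k-1) / √(1 - t^(2k-2))` of `scalingIntegral`. -/
noncomputable def scalingDensity (k : ℕ) (t : ℝ) : ℝ :=
  t ^ (k - 1) / Real.sqrt (1 - t ^ (2 * k - 2))

theorem scalingIntegral_eq (k : ℕ) :
    scalingIntegral k = fun y => ∫ t in (0 : ℝ)..y, scalingDensity k t :=
  rfl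

theorem one_sub_pow_pos {k : ℕ} (hk : 2 ≤ k) {t : ℝ} (ht : |t| < 1) :
    0 < 1 - t ^ (2 * k - 2) := by
  have h := pow_lt_one₀ (abs_nonneg t) ht (n := 2 * k - 2) (by omega)
  have := le_abs_self (t ^ (2 * k - 2))
  rw [abs_pow] at this
  linarith

theorem analyticAt_scalingDensity {k : ℕ} (hk : 2 ≤ k) {t : ℝ} (ht : |t| < 1) :
    AnalyticAt ℝ (scalingDensity k) t := by
  have h := one_sub_pow_pos hk ht
  rw [← contDiffAt_omega_iff_analyticAt]
  exact (contDiffAt_id.pow _).div ((contDiffAt_const.sub (contDiffAt_id.pow _)).sqrt h.ne')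
    (Real.sqrt_pos.2 h).ne'

theorem scalingDensity_pos {k : ℕ} (hk : 2 ≤ k) {t : ℝ} (h0 : 0 < t) (h1 : t < 1) :
    0 < scalingDensity k t :=
  div_pos (pow_pos h0 _) (Real.sqrt_pos.2 (one_sub_pow_pos hk (by rwa [abs_of_pos h0])))

/-- Since `t ^ (2 * k - 2) ≤ t` on `[0, 1]`, the density is dominated by `(1 - t) ^ (-1/2)`. -/
theorem intervalIntegrable_scalingDensity {k : ℕ} (hk : 2 ≤ k) :
    IntervalIntegrable (scalingDensity k) MeasureTheory.volume 0 1 := by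
  have h1 : IntervalIntegrable (fun t : ℝ => (1 - t) ^ (-(1 / 2) : ℝ)) MeasureTheory.volume 0 1 := by
    have := (intervalIntegral.intervalIntegrable_rpow' (a := 0) (b := 1) (r := -(1 / 2))
      (by norm_num)).comp_sub_left 1
    simpa using this.symm
  refine h1.mono_fun' ?_ ?_
  · refine Measurable.aestronglyMeasurable ?_
    unfold scalingDensity
    fun_prop
  · rw [uIoc_of_le zero_le_one]
    refine (MeasureTheory.ae_restrict_mem measurableSet_Ioc).mono fun t ht => ?_
    -- At `t = 1` the density is a division by zero, hence `0`.
    rcases ht.2.eq_or_lt with rfl | h1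
    · simp [scalingDensity]
    · have h2 : t ^ (2 * k - 2) ≤ t := pow_le_of_le_one ht.1.le ht.2 (by omega)
      have h3 : 0 < 1 - t := by linarith
      beta_reduce
      rw [Real.norm_of_nonneg (scalingDensity_pos hk ht.1 h1).le, scalingDensity,
        Real.rpow_neg h3.le, ← Real.sqrt_eq_rpow, ← one_div]
      have := Real.sqrt_pos.2 h3
      gcongr
      exact pow_le_one₀ ht.1.le ht.2

theorem hasDerivAt_scalingIntegral {k : ℕ} (hk : 2 ≤ k) {y : ℝ} (hy : |y| < 1) :
    HasDerivAt (scalingIntegral k) (scalingDensity k y) y := by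
  rw [scalingIntegral_eq]
  refine intervalIntegral.integral_hasDerivAt_right ?_ ?_
    (analyticAt_scalingDensity hk hy).continuousAt
  · refine ContinuousOn.intervalIntegrable fun t ht => ?_
    refine (analyticAt_scalingDensity hk ?_).continuousAt.continuousWithinAt
    have := abs_sub_left_of_mem_uIcc ht
    simp only [sub_zero] at this
    exact this.trans_lt hy
  · refine Measurable.stronglyMeasurable ?_ |>.stronglyMeasurableAtFilter
    unfold scalingDensity
    fun_prop

theorem eventually_hasDerivAt_scalingIntegral {k : ℕ} (hk : 2 ≤ k) {y : ℝ} (hy : |y| < 1) :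
    ∀ᶠ z in 𝓝 y, HasDerivAt (scalingIntegral k) (scalingDensity k z) z := by
  filter_upwards [continuous_abs.tendsto y |>.eventually_lt_const hy] with z hz
    using hasDerivAt_scalingIntegral hk hz

theorem analyticAt_scalingIntegral {k : ℕ} (hk : 2 ≤ k) {y : ℝ} (hy : |y| < 1) :
    AnalyticAt ℝ (scalingIntegral k) y :=
  (analyticAt_scalingDensity hk hy).of_hasDerivAt (eventually_hasDerivAt_scalingIntegral hk hy)

theorem scalingIntegral_zero (k : ℕ) : scalingIntegral k 0 = 0 := by
  simp [scalingIntegral]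

theorem continuousOn_scalingIntegral {k : ℕ} (hk : 2 ≤ k) :
    ContinuousOn (scalingIntegral k) (Icc 0 1) := by
  have := intervalIntegral.continuousOn_primitive_interval' (intervalIntegrable_scalingDensity hk)
    left_mem_uIcc
  rwa [uIcc_of_le zero_le_one] at this

theorem strictMonoOn_scalingIntegral {k : ℕ} (hk : 2 ≤ k) :
    StrictMonoOn (scalingIntegral k) (Icc 0 1) := by
  refine strictMonoOn_of_deriv_pos (convex_Icc 0 1) (continuousOn_scalingIntegral hk) ?_
  intro y hy
  rw [interior_Icc] at hy
  rw [(hasDerivAt_scalingIntegral hk (by rw [abs_of_pos hy.1]; exact hy.2)).deriv]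
  exact scalingDensity_pos hk hy.1 hy.2

theorem archimedeanRadius_pos {k : ℕ} (hk : 2 ≤ k) : 0 < archimedeanRadius k := by
  have := strictMonoOn_scalingIntegral hk (left_mem_Icc.2 zero_le_one)
    (right_mem_Icc.2 zero_le_one) zero_lt_one
  rwa [scalingIntegral_zero] at this

theorem scalingIntegral_mem_Icc {k : ℕ} (hk : 2 ≤ k) {y : ℝ} (hy : y ∈ Icc (0 : ℝ) 1) :
    scalingIntegral k y ∈ Icc 0 (archimedeanRadius k) := by
  have h := (strictMonoOn_scalingIntegral hk).monotoneOn
  have h0 := h (left_mem_Icc.2 zero_le_one) hy hy.1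
  have h1 := h hy (right_mem_Icc.2 zero_le_one) hy.2
  rw [scalingIntegral_zero] at h0
  exact ⟨h0, h1⟩

theorem archimedeanScaling_spec {k : ℕ} (hk : 2 ≤ k) {s : ℝ}
    (hs : s ∈ Icc 0 (archimedeanRadius k)) :
    archimedeanScaling k s ∈ Icc (0 : ℝ) 1 ∧ scalingIntegral k (archimedeanScaling k s) = s := by
  have h : s ∈ scalingIntegral k '' Icc 0 1 := by
    refine intermediate_value_Icc zero_le_one (continuousOn_scalingIntegral hk) ?_
    rwa [scalingIntegral_zero]
  exact ⟨Function.invFunOn_mem h, Function.invFunOn_eq h⟩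

theorem eq_archimedeanScaling_iff {k : ℕ} (hk : 2 ≤ k) {s y : ℝ}
    (hs : s ∈ Icc 0 (archimedeanRadius k)) (hy : 0 ≤ y) :
    y = archimedeanScaling k s ↔ y ≤ 1 ∧ scalingIntegral k y = s := by
  obtain ⟨h1, h2⟩ := archimedeanScaling_spec hk hs
  constructor
  · rintro rfl
    exact ⟨h1.2, h2⟩
  · rintro ⟨h3, h4⟩
    exact (strictMonoOn_scalingIntegral hk).injOn ⟨hy, h3⟩ h1 (h4.trans h2.symm)

/-! ### Expansions of the scaling integral at `0` and `1` -/

/-- Near the origin, `scalingIntegral k y = y ^ k * H (y ^ 2)` with `H` analytic. -/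
theorem exists_scalingIntegral_eq_pow_mul {k : ℕ} (hk : 2 ≤ k) :
    ∃ H : ℝ → ℝ, AnalyticAt ℝ H 0 ∧ H 0 ≠ 0 ∧
      ∀ᶠ y in 𝓝 (0 : ℝ), scalingIntegral k y = y ^ k * H (y ^ 2) := by
  obtain ⟨j, rfl⟩ : ∃ j, k = j + 1 := ⟨k - 1, by omega⟩
  have hj : j ≠ 0 := by omega
  have hj1 : (0 : ℝ) < j + 1 := by positivity
  have hb : AnalyticAt ℝ (fun u : ℝ => 1 / Real.sqrt (1 - u ^ j)) 0 := by
    rw [← contDiffAt_omega_iff_analyticAt]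
    refine contDiffAt_const.div ((contDiffAt_const.sub (contDiffAt_id.pow _)).sqrt ?_) ?_ <;>
      simp [hj]
  -- The derivative of `y ^ (j + 1) * A (y ^ 2) / (j + 1)` is `y ^ j` times `A u + 2 / (j + 1) * u *
  -- A' u` at `u = y ^ 2`, whence this `c`.
  obtain ⟨A, hA, h⟩ := hb.exists_add_mul_deriv_eq (c := 2 / (j + 1)) (by positivity)
  have hsq : Tendsto (fun y : ℝ => y ^ 2) (𝓝 0) (𝓝 0) := by
    simpa using (continuous_pow 2).tendsto (0 : ℝ)
  have hder : ∀ᶠ y in 𝓝 (0 : ℝ), HasDerivAt (fun y => y ^ (j + 1) * (A (y ^ 2) / (j + 1)))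
      (scalingDensity (j + 1) y) y := by
    filter_upwards [hsq.eventually h, hsq.eventually hA.eventually_analyticAt] with y h1 h2
    have h3 : HasDerivAt (fun y => A (y ^ 2)) _ y :=
      HasDerivAt.comp (h₂ := A) (h := fun y => y ^ 2) y h2.differentiableAt.hasDerivAt
        (hasDerivAt_pow 2 y)
    convert! (hasDerivAt_pow (j + 1) y).mul (h3.div_const ((j : ℝ) + 1)) using 1
    have h4 : scalingDensity (j + 1) y = y ^ j * (1 / Real.sqrt (1 - (y ^ 2) ^ j)) := by
      rw [scalingDensity, ← pow_mul, mul_one_div]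
      rfl
    rw [h4, ← h1]
    simp only [Nat.add_sub_cancel, Nat.cast_add, Nat.cast_one]
    field_simp
    ring
  have h0 := h.self_of_nhds
  simp only [ne_eq, hj, not_false_eq_true, zero_pow, sub_zero, Real.sqrt_one, mul_zero, zero_mul,
    add_zero, div_one] at h0
  refine ⟨fun u => A u / (j + 1), hA.div analyticAt_const hj1.ne', ?_, ?_⟩
  · simp only [h0]
    positivity
  · have := eventually_sub_eq_of_hasDerivAt
      (eventually_hasDerivAt_scalingIntegral hk (by simp : |(0 : ℝ)| < 1)) hder
    simpa [scalingIntegral_zero] using this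

/-- Near `y = 1`, the square of `M_k - ∫₀^y` is the restriction of an analytic function with a
simple zero. -/
theorem exists_sq_archimedeanRadius_sub {k : ℕ} (hk : 2 ≤ k) :
    ∃ A : ℝ → ℝ, AnalyticAt ℝ A 0 ∧ A 0 ≠ 0 ∧ ∀ᶠ y in 𝓝 (1 : ℝ), y ≤ 1 →
      (archimedeanRadius k - scalingIntegral k y) ^ 2 = (1 - y) * A (1 - y) ^ 2 := by
  have hS : ∀ t : ℝ, 0 < t → 0 < ∑ i ∈ Finset.range (2 * k - 2), t ^ i := fun t ht =>
    Finset.sum_pos (fun i _ => pow_pos ht i) ⟨0, by simp; omega⟩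
  -- Substitute `t = 1 - x ^ 2`, `u = x ^ 2`. The geometric sum is `(1 - t ^ (2k-2)) / (1 - t)`; the
  -- singular factor `1 / x` cancels against `|dt/dx| = 2 x`, leaving the 2. With `c = 2`, `b (x ^
  -- 2)` is the derivative of `x * A (x ^ 2)`.
  let b : ℝ → ℝ := fun u =>
    2 * ((1 - u) ^ (k - 1) / Real.sqrt (∑ i ∈ Finset.range (2 * k - 2), (1 - u) ^ i))
  have hb : AnalyticAt ℝ b 0 := by
    have h0 := hS (1 - 0) (by norm_num)
    rw [← contDiffAt_omega_iff_analyticAt]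
    refine contDiffAt_const.mul (((contDiffAt_const.sub contDiffAt_id).pow _).div
      (ContDiffAt.sqrt (ContDiffAt.sum fun i _ => (contDiffAt_const.sub contDiffAt_id).pow _) h0.ne')
      (Real.sqrt_pos.2 h0).ne')
  obtain ⟨A, hA, h⟩ := hb.exists_add_mul_deriv_eq (c := 2) zero_le_two
  have hA0 : A 0 ≠ 0 := by
    have h0 := h.self_of_nhds
    simp only [mul_zero, zero_mul, add_zero] at h0
    rw [h0]
    have := Real.sqrt_pos.2 (hS (1 - 0) (by norm_num))
    simp only [b]
    positivity
  refine ⟨A, hA, hA0, ?_⟩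
  obtain ⟨ε, hε, hball⟩ := Metric.eventually_nhds_iff_ball.1 (h.and hA.eventually_analyticAt)
  have hball' (s : ℝ) (hs : s ^ 2 < ε) : A (s ^ 2) + 2 * s ^ 2 * deriv A (s ^ 2) = b (s ^ 2) ∧
      AnalyticAt ℝ A (s ^ 2) := by
    refine hball _ ?_
    rwa [Metric.mem_ball, dist_zero_right, Real.norm_of_nonneg (sq_nonneg s)]
  filter_upwards [lt_mem_nhds (show (0 : ℝ) < 1 by norm_num),
    lt_mem_nhds (show 1 - ε < (1 : ℝ) by linarith)] with y hy0 hyε hy1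
  rcases hy1.eq_or_lt with rfl | hy1
  · simp [archimedeanRadius]
  set s := Real.sqrt (1 - y) with hs_def
  have hs : s ^ 2 = 1 - y := Real.sq_sqrt (by linarith)
  have hs0 : 0 < s := Real.sqrt_pos.2 (by linarith)
  have hA' (x : ℝ) (hx : x ^ 2 < ε) : HasDerivAt (fun x => x * A (x ^ 2)) (b (x ^ 2)) x := by
    obtain ⟨h1, h2⟩ := hball' x hx
    have h3 : HasDerivAt (fun x => A (x ^ 2)) _ x :=
      HasDerivAt.comp (h₂ := A) (h := fun x => x ^ 2) x h2.differentiableAt.hasDerivAt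
      (hasDerivAt_pow 2 x)
    convert! (hasDerivAt_id x).mul h3 using 1
    rw [← h1]
    simp
    ring
  have hx2 {x : ℝ} (hx : x ∈ Icc 0 s) : x ^ 2 ≤ 1 - y := by
    rw [← hs]
    exact pow_le_pow_left₀ hx.1 hx.2 2
  have hcont : ContinuousOn (fun x => scalingIntegral k (1 - x ^ 2) + x * A (x ^ 2)) (Icc 0 s) := by
    refine ContinuousOn.add ?_ fun x hx => ?_
    · refine (continuousOn_scalingIntegral hk).comp (by fun_prop) fun x hx => ?_
      have := hx2 hx
      exact ⟨by linarith, by nlinarith⟩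
    · exact (hA' x (by linarith [hx2 hx])).continuousAt.continuousWithinAt
  have hderiv (x : ℝ) (hx : x ∈ Ioo 0 s) :
      HasDerivAt (fun x => scalingIntegral k (1 - x ^ 2) + x * A (x ^ 2)) 0 x := by
    have h1 := hx2 ⟨hx.1.le, hx.2.le⟩
    have h0 : 0 < x ^ 2 := pow_pos hx.1 2
    have ht0 : 0 < 1 - x ^ 2 := by linarith
    have h2 : HasDerivAt (fun x => scalingIntegral k (1 - x ^ 2)) _ x :=
      HasDerivAt.comp (h₂ := scalingIntegral k) (h := fun x => 1 - x ^ 2) x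
        (hasDerivAt_scalingIntegral hk (by rw [abs_of_pos ht0]; linarith))
        ((hasDerivAt_pow 2 x).const_sub 1)
    convert! h2.add (hA' x (by linarith)) using 1
    have h3 : 1 - (1 - x ^ 2) ^ (2 * k - 2) =
        x ^ 2 * ∑ i ∈ Finset.range (2 * k - 2), (1 - x ^ 2) ^ i := by
      rw [← mul_neg_geom_sum, sub_sub_cancel]
    have h4 := (Real.sqrt_pos.2 (hS _ ht0)).ne'
    simp only [scalingDensity, b]
    rw [h3, Real.sqrt_mul (sq_nonneg x), Real.sqrt_sq hx.1.le]
    have := hx.1.ne'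
    simp only [Nat.cast_ofNat, Nat.add_one_sub_one, pow_one]
    field_simp
    ring
  -- The mean value theorem needs only continuity at `x = 0`, where the derivative of
  -- `scalingIntegral k` is unavailable.
  obtain ⟨c, -, hc'⟩ := exists_hasDerivAt_eq_slope _ (fun _ => 0) hs0 hcont hderiv
  have h1 : scalingIntegral k (1 - s ^ 2) + s * A (s ^ 2) = archimedeanRadius k := by
    rw [eq_div_iff (by linarith)] at hc'
    simp only [ne_eq, OfNat.ofNat_ne_zero, not_false_eq_true, zero_pow, sub_zero, zero_mul,
      add_zero] at hc'
    rw [archimedeanRadius]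
    linarith
  rw [hs, sub_sub_cancel] at h1
  rw [← h1, add_sub_cancel_left, mul_pow, hs]

/-! ### The array as an equation between norms -/

theorem infDist_sphere_zero_eq {E : Type*} [NormedAddCommGroup E] [NormedSpace ℝ E] [Nontrivial E]
    {R : ℝ} {x : E} (hx : ‖x‖ ≤ R) : Metric.infDist x (Metric.sphere 0 R) = R - ‖x‖ := by
  have hR : 0 ≤ R := (norm_nonneg x).trans hx
  refine le_antisymm ?_ ?_
  · rcases eq_or_ne x 0 with rfl | hx0
    · obtain ⟨y, hy⟩ := (NormedSpace.sphere_nonempty (x := (0 : E))).2 hR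
      refine (Metric.infDist_le_dist_of_mem hy).trans ?_
      rw [mem_sphere_zero_iff_norm] at hy
      simp [hy]
    · have hx' : 0 < ‖x‖ := norm_pos_iff.2 hx0
      have hy : (R / ‖x‖) • x ∈ Metric.sphere (0 : E) R := by
        simp [norm_smul, abs_of_nonneg hR, hx'.ne']
      refine (Metric.infDist_le_dist_of_mem hy).trans ?_
      have h1 : x - (R / ‖x‖) • x = (1 - R / ‖x‖) • x := by rw [sub_smul, one_smul]
      have h2 : 1 - R / ‖x‖ ≤ 0 := by
        rw [sub_nonpos, one_le_div hx']
        exact hx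
      rw [dist_eq_norm, h1, norm_smul, Real.norm_of_nonpos h2]
      apply le_of_eq
      field_simp
      ring
  · rw [Metric.le_infDist (NormedSpace.sphere_nonempty.2 hR)]
    intro y hy
    rw [mem_sphere_zero_iff_norm] at hy
    rw [← hy, dist_comm, dist_eq_norm]
    exact norm_sub_norm_le y x

/-- This eliminates the inverse function and the distance to the boundary; all later arguments use
only this form. -/
theorem mem_archimedeanSphericalArray_iff {n k : ℕ} (hk : 2 ≤ k) (hkn : k < n)
    (p : WithLp 2 (EuclideanSpace ℝ (Fin (n - k)) × EuclideanSpace ℝ (Fin k))) :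
    p ∈ archimedeanSphericalArray n k ↔
      ‖p.snd‖ ≤ 1 ∧ ‖p.fst‖ = archimedeanRadius k - scalingIntegral k ‖p.snd‖ := by
  have : Nonempty (Fin (n - k)) := ⟨⟨0, by omega⟩⟩
  have hM := archimedeanRadius_pos hk
  simp only [archimedeanSphericalArray, sphericalArray, archimedeanBase, mem_ofPred_eq,
    frontier_closedBall _ hM.ne', mem_closedBall_zero_iff]
  constructor
  · rintro ⟨h1, h2⟩
    rw [infDist_sphere_zero_eq h1] at h2
    have hs : archimedeanRadius k - ‖p.fst‖ ∈ Icc 0 (archimedeanRadius k) :=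
      ⟨by linarith, by linarith [norm_nonneg p.fst]⟩
    have h3 := (pow_left_inj₀ (norm_nonneg _) (archimedeanScaling_spec hk hs).1.1 two_ne_zero).1 h2
    obtain ⟨h4, h5⟩ := (eq_archimedeanScaling_iff hk hs (norm_nonneg _)).1 h3
    exact ⟨h4, by linarith⟩
  · rintro ⟨h1, h2⟩
    have h3 := scalingIntegral_mem_Icc hk ⟨norm_nonneg p.snd, h1⟩
    have h4 : ‖p.fst‖ ≤ archimedeanRadius k := by linarith [h3.1]
    have hs : archimedeanRadius k - ‖p.fst‖ ∈ Icc 0 (archimedeanRadius k) :=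
      ⟨by linarith, by linarith [norm_nonneg p.fst]⟩
    refine ⟨h4, ?_⟩
    rw [infDist_sphere_zero_eq h4, ← (eq_archimedeanScaling_iff hk hs (norm_nonneg _)).2
      ⟨h1, by linarith⟩]

/-! ### Regular defining functions -/

/-- A set that is given near `p` by an equation `‖x''‖² = Q x'` has a regular defining function
at `p`, unless `p` is a critical point of `‖x''‖² - Q x'`. -/
theorem exists_definingFunction_of_norm_sq_eq {E₁ E₂ : Type*} [NormedAddCommGroup E₁]
    [InnerProductSpace ℝ E₁] [NormedAddCommGroup E₂] [InnerProductSpace ℝ E₂]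
    {r : WithTop ℕ∞} (hr : r ≠ ∞) (hr0 : r ≠ 0) {S : Set (WithLp 2 (E₁ × E₂))}
    {p : WithLp 2 (E₁ × E₂)} {Q : E₂ → ℝ} (hQ : ContDiffAt ℝ r Q p.snd)
    (hS : ∀ᶠ x in 𝓝 p.snd, ∀ z : WithLp 2 (E₁ × E₂), z.snd = x → (z ∈ S ↔ ‖z.fst‖ ^ 2 = Q x))
    (hp : p.fst ≠ 0 ∨ fderiv ℝ Q p.snd ≠ 0) :
    ∃ U : Set (WithLp 2 (E₁ × E₂)), IsOpen U ∧ p ∈ U ∧ ∃ F : WithLp 2 (E₁ × E₂) → ℝ,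
      ContDiffOn ℝ r F U ∧ fderiv ℝ F p ≠ 0 ∧ S ∩ U = {x ∈ U | F x = 0} := by
  let π₁ := WithLp.fstL 2 ℝ E₁ E₂
  let π₂ := WithLp.sndL 2 ℝ E₁ E₂
  -- Being `C^r` at a point spreads to a neighbourhood only for `r ≠ ∞`.
  have hev : ∀ᶠ x in 𝓝 p.snd, ContDiffAt ℝ r Q x ∧
      ∀ z : WithLp 2 (E₁ × E₂), z.snd = x → (z ∈ S ↔ ‖z.fst‖ ^ 2 = Q x) := (hQ.eventually hr).and hS
  obtain ⟨V, hV, hVo, hpV⟩ := eventually_nhds_iff.1 hev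
  refine ⟨π₂ ⁻¹' V, hVo.preimage π₂.continuous, hpV, fun z => ‖π₁ z‖ ^ 2 - Q (π₂ z), ?_, ?_, ?_⟩
  · intro z hz
    refine ContDiffAt.contDiffWithinAt ?_
    exact (π₁.contDiff.contDiffAt.norm_sq ℝ).sub
      (ContDiffAt.comp (g := Q) z (hV _ hz).1 π₂.contDiff.contDiffAt)
  · have h1 : HasFDerivAt (fun z => ‖π₁ z‖ ^ 2) _ p := π₁.hasFDerivAt.norm_sq
    have h2 : HasFDerivAt (fun z => Q (π₂ z)) ((fderiv ℝ Q p.snd).comp π₂) p :=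
      HasFDerivAt.comp (g := Q) p (hQ.differentiableAt hr0).hasFDerivAt π₂.hasFDerivAt
    rw [(h1.fun_sub h2).fderiv]
    intro h0
    have h3 (v : E₁) (w : E₂) : 2 * inner ℝ p.fst v - fderiv ℝ Q p.snd w = 0 := by
      have := DFunLike.congr_fun h0 (WithLp.toLp 2 (v, w))
      simpa [π₁, π₂] using this
    rcases hp with hp | hp
    · have := h3 p.fst 0
      simp at this
      exact hp this
    · refine hp (ContinuousLinearMap.ext fun w => ?_)
      have := h3 0 w
      simpa using this
  · ext z
    simp only [mem_inter_iff, mem_preimage, mem_ofPred_eq, sub_eq_zero]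
    constructor
    · rintro ⟨h1, h2⟩
      exact ⟨h2, ((hV _ h2).2 z rfl).1 h1⟩
    · rintro ⟨h1, h2⟩
      exact ⟨((hV _ h1).2 z rfl).2 h2, h1⟩

/-- Only the origin is delicate; there the factor `H (‖x‖ ^ 2)` is smooth, which leaves `‖x‖ ^ k`.
-/
theorem contDiffAt_scalingIntegral_norm {E : Type*} [NormedAddCommGroup E] [InnerProductSpace ℝ E]
    {k : ℕ} (hk : 2 ≤ k) {r : WithTop ℕ∞} (hr : ContDiffAt ℝ r (fun x : E => ‖x‖ ^ k) 0)
    {x : E} (hx : ‖x‖ < 1) : ContDiffAt ℝ r (fun x => scalingIntegral k ‖x‖) x := by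
  rcases eq_or_ne x 0 with rfl | hx0
  · obtain ⟨H, hH, -, h⟩ := exists_scalingIntegral_eq_pow_mul hk
    have h1 : (fun x : E => scalingIntegral k ‖x‖) =ᶠ[𝓝 0] fun x => ‖x‖ ^ k * H (‖x‖ ^ 2) :=
      (tendsto_norm_zero (E := E)).eventually h
    refine ContDiffAt.congr_of_eventuallyEq (hr.mul ?_) h1
    have h2 : ContDiffAt ℝ r H (‖(0 : E)‖ ^ 2) := by
      simpa using (contDiffAt_omega_iff_analyticAt.2 hH).of_le le_top
    exact ContDiffAt.comp (g := H) 0 h2 (contDiff_norm_sq ℝ).contDiffAt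
  · have h1 : ContDiffAt ℝ r (scalingIntegral k) ‖x‖ :=
      (contDiffAt_omega_iff_analyticAt.2
        (analyticAt_scalingIntegral hk (by rwa [abs_norm]))).of_le le_top
    exact ContDiffAt.comp (g := scalingIntegral k) x h1 (contDiffAt_norm ℝ hx0)

/-- The Archimedean spherical array is as smooth as the function `‖x'‖ ^ k` on `ℝ^k`. -/
theorem isHypersurfaceOfClass_archimedeanSphericalArray {n k : ℕ} (hk : 2 ≤ k) (hkn : k < n)
    {r : WithTop ℕ∞} (hr : r ≠ ∞) (hr0 : r ≠ 0)
    (hnorm : ContDiffAt ℝ r (fun x : EuclideanSpace ℝ (Fin k) => ‖x‖ ^ k) 0) :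
    IsHypersurfaceOfClass r (archimedeanSphericalArray n k) := by
  intro p hp
  obtain ⟨hp1, hp2⟩ := (mem_archimedeanSphericalArray_iff hk hkn p).1 hp
  have hmem (z : WithLp 2 (EuclideanSpace ℝ (Fin (n - k)) × EuclideanSpace ℝ (Fin k)))
      (hz : ‖z.snd‖ ≤ 1) : z ∈ archimedeanSphericalArray n k ↔
        ‖z.fst‖ ^ 2 = (archimedeanRadius k - scalingIntegral k ‖z.snd‖) ^ 2 := by
    have := (scalingIntegral_mem_Icc hk ⟨norm_nonneg z.snd, hz⟩).2
    rw [mem_archimedeanSphericalArray_iff hk hkn, and_iff_right hz,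
      pow_left_inj₀ (norm_nonneg _) (by linarith) two_ne_zero]
  rcases hp1.lt_or_eq with hlt | heq
  · refine exists_definingFunction_of_norm_sq_eq hr hr0
      (Q := fun x => (archimedeanRadius k - scalingIntegral k ‖x‖) ^ 2) ?_ ?_ (Or.inl ?_)
    · exact (contDiffAt_const.sub (contDiffAt_scalingIntegral_norm hk hnorm hlt)).pow 2
    · filter_upwards [continuous_norm.tendsto p.snd |>.eventually_lt_const hlt]
      rintro _ hz z rfl
      exact hmem z hz.le
    · have := strictMonoOn_scalingIntegral hk ⟨norm_nonneg _, hp1⟩ (right_mem_Icc.2 zero_le_one) hlt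
      rw [← norm_pos_iff, hp2, sub_pos]
      exact this
  · have hp0 : p.snd ≠ 0 := by
      rw [← norm_pos_iff, heq]
      exact one_pos
    obtain ⟨A, hA, hA0, hev⟩ := exists_sq_archimedeanRadius_sub hk
    have hq : AnalyticAt ℝ (fun y => (1 - y) * A (1 - y) ^ 2) 1 := by
      have : AnalyticAt ℝ (fun y => A (1 - y)) 1 :=
        AnalyticAt.fun_comp (by simpa using hA) (analyticAt_const.sub analyticAt_id)
      exact (analyticAt_const.sub analyticAt_id).mul (this.pow 2)
    have hQ : ContDiffAt ℝ r
        (fun x : EuclideanSpace ℝ (Fin k) => (1 - ‖x‖) * A (1 - ‖x‖) ^ 2) p.snd := by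
      refine ContDiffAt.comp (g := fun y => (1 - y) * A (1 - y) ^ 2) p.snd ?_
        (contDiffAt_norm ℝ hp0)
      rw [heq]
      exact (contDiffAt_omega_iff_analyticAt.2 hq).of_le le_top
    have hsub : Tendsto (fun y : ℝ => 1 - y) (𝓝 1) (𝓝 0) := by
      simpa using (continuous_sub_left (1 : ℝ)).tendsto 1
    have hnear := hev.and (hsub.eventually (hA.continuousAt.eventually_ne hA0))
    have hsnd : Tendsto norm (𝓝 p.snd) (𝓝 1) := by
      simpa [heq] using continuous_norm.tendsto p.snd
    refine exists_definingFunction_of_norm_sq_eq hr hr0 hQ ?_ (Or.inr ?_)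
    · filter_upwards [hsnd.eventually hnear]
      rintro _ ⟨h1, h2⟩ z rfl
      rcases le_or_gt ‖z.snd‖ 1 with h3 | h3
      · rw [hmem z h3, h1 h3]
      -- Outside the unit ball the right side is negative, so the extended equation adds no points.
      · refine iff_of_false (fun h => ?_) fun h => ?_
        · exact h3.not_ge ((mem_archimedeanSphericalArray_iff hk hkn z).1 h).1
        · have := mul_pos (sub_pos.2 h3) (sq_pos_iff.2 h2)
          linarith [sq_nonneg ‖z.fst‖]
    · intro h0
      have h1 := (hQ.differentiableAt hr0).hasFDerivAt
      rw [h0] at h1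
      -- Along the ray through `p.snd` the function has derivative `-A 0 ^ 2` at `t = 1`, which is
      -- nonzero.
      have h2 : HasDerivAt (fun t : ℝ => t • p.snd) p.snd 1 := by
        simpa using (hasDerivAt_id (1 : ℝ)).smul_const p.snd
      have h3 := HasFDerivAt.comp_hasDerivAt (l := fun x : EuclideanSpace ℝ (Fin k) =>
        (1 - ‖x‖) * A (1 - ‖x‖) ^ 2) (f := fun t : ℝ => t • p.snd) 1 (by rwa [one_smul]) h2
      have h4 : (fun t : ℝ => (1 - t) * A (1 - t) ^ 2) =ᶠ[𝓝 1] ((fun x : EuclideanSpace ℝ (Fin k) =>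
          (1 - ‖x‖) * A (1 - ‖x‖) ^ 2) ∘ fun t : ℝ => t • p.snd) := by
        filter_upwards [lt_mem_nhds (zero_lt_one (α := ℝ))] with t ht
        simp [norm_smul, heq, abs_of_pos ht]
      have h5 := h3.congr_of_eventuallyEq h4
      have h6 : HasDerivAt (fun t : ℝ => A (1 - t)) (deriv A 0 * -1) 1 :=
        HasDerivAt.comp (h₂ := A) (h := fun t => 1 - t) 1
          (by simpa using hA.differentiableAt.hasDerivAt) ((hasDerivAt_id (1 : ℝ)).const_sub 1)
      have h7 := ((hasDerivAt_id (1 : ℝ)).const_sub 1).mul (h6.pow 2)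
      have h8 := h7.unique h5
      simp at h8
      exact hA0 h8

/-! ### Tangent directions and the failure of `C^k` -/

theorem fderiv_apply_eq_zero_of_curve {E : Type*} [NormedAddCommGroup E] [NormedSpace ℝ E]
    {F : E → ℝ} {p v : E} {c : ℝ → E} (hF : DifferentiableAt ℝ F p) (hc : HasDerivAt c v 0)
    (hc0 : c 0 = p) (h : ∀ᶠ t in 𝓝 0, F (c t) = 0) : fderiv ℝ F p v = 0 := by
  subst hc0
  have h1 := hF.hasFDerivAt.comp_hasDerivAt 0 hc
  have h2 : F ∘ c =ᶠ[𝓝 0] fun _ => 0 := h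
  exact h1.unique ((hasDerivAt_const (0 : ℝ) (0 : ℝ)).congr_of_eventuallyEq h2)

theorem HasDerivAt.toLp_prodMk {E₁ E₂ : Type*} [NormedAddCommGroup E₁] [NormedSpace ℝ E₁]
    [NormedAddCommGroup E₂] [NormedSpace ℝ E₂] {a : ℝ → E₁} {b : ℝ → E₂} {v : E₁} {w : E₂} {t : ℝ}
    (ha : HasDerivAt a v t) (hb : HasDerivAt b w t) :
    HasDerivAt (fun t => WithLp.toLp 2 (a t, b t)) (WithLp.toLp 2 (v, w)) t :=
  (WithLp.prodContinuousLinearEquiv 2 ℝ E₁ E₂).symm.toContinuousLinearMap.hasFDerivAt.comp_hasDerivAt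
    t (ha.prodMk hb)

/-- The function is at least `C^1` because `k - 1 ≥ 1`, and it has a minimum at the origin. -/
theorem hasFDerivAt_scalingIntegral_norm_zero {k : ℕ} (hk : 2 ≤ k) :
    HasFDerivAt (fun x : EuclideanSpace ℝ (Fin k) => scalingIntegral k ‖x‖)
      (0 : EuclideanSpace ℝ (Fin k) →L[ℝ] ℝ) 0 := by
  obtain ⟨j, rfl⟩ : ∃ j, k = j + 1 := ⟨k - 1, by omega⟩
  have h1 : DifferentiableAt ℝ
      (fun x : EuclideanSpace ℝ (Fin (j + 1)) => scalingIntegral (j + 1) ‖x‖) 0 :=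
    (contDiffAt_scalingIntegral_norm hk (contDiff_norm_pow_succ j).contDiffAt
      (by simp)).differentiableAt (by simp; omega)
  have h2 : IsLocalMin
      (fun x : EuclideanSpace ℝ (Fin (j + 1)) => scalingIntegral (j + 1) ‖x‖) 0 := by
    filter_upwards [Metric.closedBall_mem_nhds 0 one_pos] with x hx
    rw [norm_zero, scalingIntegral_zero]
    exact (scalingIntegral_mem_Icc hk ⟨norm_nonneg x, by simpa using hx⟩).1
  rw [← h2.fderiv_eq_zero]
  exact h1.hasFDerivAt

theorem toLp_smul_mem_archimedeanSphericalArray {n k : ℕ} (hk : 2 ≤ k) (hkn : k < n)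
    {e : EuclideanSpace ℝ (Fin (n - k))}
    (he : ‖e‖ = 1) {x : EuclideanSpace ℝ (Fin k)} (hx : ‖x‖ ≤ 1) :
    WithLp.toLp 2 ((archimedeanRadius k - scalingIntegral k ‖x‖) • e, x) ∈
      archimedeanSphericalArray n k := by
  rw [mem_archimedeanSphericalArray_iff hk hkn]
  have := (scalingIntegral_mem_Icc hk ⟨norm_nonneg x, hx⟩).2
  refine ⟨hx, ?_⟩
  rw [WithLp.toLp_fst, WithLp.toLp_snd, norm_smul, he, mul_one, Real.norm_of_nonneg (by linarith)]

/-- A nonzero functional on `E₁ × E₂` that kills `E₂` and `e^⊥` does not kill the unit vector `e`. -/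
theorem apply_toLp_ne_zero {E₁ E₂ : Type*} [NormedAddCommGroup E₁] [InnerProductSpace ℝ E₁]
    [NormedAddCommGroup E₂] [NormedSpace ℝ E₂] {e : E₁} (he : ‖e‖ = 1)
    {L : WithLp 2 (E₁ × E₂) →L[ℝ] ℝ} (hL : L ≠ 0) (hvert : ∀ w, L (WithLp.toLp 2 (0, w)) = 0)
    (hunit : ∀ w, ‖w‖ = 1 → inner ℝ e w = 0 → L (WithLp.toLp 2 (w, 0)) = 0) :
    L (WithLp.toLp 2 (e, 0)) ≠ 0 := by
  have hsmul (c : ℝ) (w : E₁) : L (WithLp.toLp 2 (c • w, 0)) = c * L (WithLp.toLp 2 (w, 0)) := by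
    rw [← smul_eq_mul, ← map_smul, ← WithLp.toLp_smul, Prod.smul_mk, smul_zero]
  have hperp (w : E₁) (hew : inner ℝ e w = 0) : L (WithLp.toLp 2 (w, 0)) = 0 := by
    rcases eq_or_ne w 0 with rfl | hw
    · exact hvert 0
    · have hw' := norm_ne_zero_iff.2 hw
      have h1 := hunit (‖w‖⁻¹ • w) (by simp [norm_smul, hw']) (by simp [inner_smul_right, hew])
      rw [hsmul] at h1
      exact (mul_eq_zero.1 h1).resolve_left (inv_ne_zero hw')
  intro h0
  refine hL (ContinuousLinearMap.ext fun z => ?_)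
  have hz : z = WithLp.toLp 2 (inner ℝ e z.fst • e, 0) +
      WithLp.toLp 2 (z.fst - inner ℝ e z.fst • e, 0) + WithLp.toLp 2 (0, z.snd) := by
    rw [← WithLp.toLp_add, ← WithLp.toLp_add]
    apply (WithLp.equiv 2 _).injective
    ext1 <;> simp
  have hz' : inner ℝ e (z.fst - inner ℝ e z.fst • e) = 0 := by
    rw [inner_sub_right, inner_smul_right, real_inner_self_eq_norm_sq, he]
    simp
  rw [hz, map_add, map_add, hsmul, h0, hvert, hperp _ hz']
  simp

theorem hasDerivAt_profile_curve {E₁ E₂ : Type*} [NormedAddCommGroup E₁] [NormedSpace ℝ E₁]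
    [NormedAddCommGroup E₂] [NormedSpace ℝ E₂] {g : E₂ → ℝ} (hg : HasFDerivAt g (0 : E₂ →L[ℝ] ℝ) 0)
    (R : ℝ) (e : E₁) (w : E₂) :
    HasDerivAt (fun t : ℝ => WithLp.toLp 2 ((R - g (t • w)) • e, t • w))
      (WithLp.toLp 2 (0, w)) 0 := by
  have h1 : HasDerivAt (fun t : ℝ => t • w) w 0 := by
    simpa using (hasDerivAt_id (0 : ℝ)).smul_const w
  have h2 : HasDerivAt (fun t : ℝ => g (t • w)) 0 0 :=
    HasFDerivAt.comp_hasDerivAt (l := g) (f := fun t : ℝ => t • w) (l' := 0) 0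
      (by rwa [zero_smul]) h1
  have h3 := (h2.const_sub R).smul_const e
  rw [neg_zero, zero_smul] at h3
  exact h3.toLp_prodMk h1

theorem hasDerivAt_rotation_curve {E₁ : Type*} [NormedAddCommGroup E₁] [NormedSpace ℝ E₁]
    (R : ℝ) (e w : E₁) :
    HasDerivAt (fun t : ℝ => R • (Real.cos t • e + Real.sin t • w)) (R • w) 0 := by
  have h1 := ((Real.hasDerivAt_cos 0).smul_const e).fun_add
    ((Real.hasDerivAt_sin 0).smul_const w)
  rw [Real.sin_zero, Real.cos_zero, neg_zero, zero_smul, zero_add, one_smul] at h1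
  exact h1.fun_const_smul R

theorem norm_cos_smul_add_sin_smul {E₁ : Type*} [NormedAddCommGroup E₁] [InnerProductSpace ℝ E₁]
    {e w : E₁} (he : ‖e‖ = 1) (hw : ‖w‖ = 1) (hew : inner ℝ e w = 0) (t : ℝ) :
    ‖Real.cos t • e + Real.sin t • w‖ = 1 := by
  rw [← sq_eq_sq₀ (norm_nonneg _) zero_le_one, norm_add_sq_real, norm_smul, norm_smul,
    inner_smul_left, inner_smul_right, hew, he, hw]
  simp

/-- Let `S` contain the graphs `‖x''‖ = R - g x'` near `x' = 0`, where `g` has a critical point with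
value `0` at `0`. Then the differential at `(R e, 0)` of a regular defining function of `S` does not
vanish on the radial direction. -/
theorem fderiv_radial_ne_zero {E₁ E₂ : Type*} [NormedAddCommGroup E₁] [InnerProductSpace ℝ E₁]
    [NormedAddCommGroup E₂] [NormedSpace ℝ E₂] {g : E₂ → ℝ} (hg : HasFDerivAt g (0 : E₂ →L[ℝ] ℝ) 0)
    (hg0 : g 0 = 0) {R : ℝ} (hR : R ≠ 0) {S : Set (WithLp 2 (E₁ × E₂))}
    (hgS : ∀ e : E₁, ‖e‖ = 1 → ∀ᶠ x in 𝓝 0, WithLp.toLp 2 ((R - g x) • e, x) ∈ S)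
    {e : E₁} (he : ‖e‖ = 1) {p : WithLp 2 (E₁ × E₂)} (hp : p = WithLp.toLp 2 (R • e, 0))
    {F : WithLp 2 (E₁ × E₂) → ℝ} (hF : DifferentiableAt ℝ F p) (hF0 : fderiv ℝ F p ≠ 0)
    (hS : ∀ᶠ z in 𝓝 p, z ∈ S → F z = 0) : fderiv ℝ F p (WithLp.toLp 2 (e, 0)) ≠ 0 := by
  have key {c : ℝ → WithLp 2 (E₁ × E₂)} {v} (hc : HasDerivAt c v 0) (hc0 : c 0 = p)
      (h : ∀ᶠ t in 𝓝 0, c t ∈ S) : fderiv ℝ F p v = 0 := by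
    refine fderiv_apply_eq_zero_of_curve hF hc hc0 ?_
    have h1 := hc.continuousAt.tendsto
    rw [hc0] at h1
    filter_upwards [h1.eventually hS, h] with t h2 h3 using h2 h3
  refine apply_toLp_ne_zero he hF0 (fun w => ?_) fun w hw hew => ?_
  · refine key (hasDerivAt_profile_curve hg R e w) ?_ ?_
    · rw [hp, zero_smul, hg0, sub_zero]
    · have h4 : Tendsto (fun t : ℝ => t • w) (𝓝 0) (𝓝 0) := by
        have : Continuous fun t : ℝ => t • w := by fun_prop
        simpa only [zero_smul] using this.tendsto 0
      exact h4.eventually (hgS e he)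
  · have h5 (t : ℝ) : WithLp.toLp 2 (R • (Real.cos t • e + Real.sin t • w), 0) ∈ S := by
      have := (hgS _ (norm_cos_smul_add_sin_smul he hw hew t)).self_of_nhds
      rwa [hg0, sub_zero] at this
    have h2 := key ((hasDerivAt_rotation_curve R e w).toLp_prodMk
      (hasDerivAt_const (0 : ℝ) (0 : E₂))) ?_ (Eventually.of_forall h5)
    · have h3 : (WithLp.toLp 2 (R • w, (0 : E₂))) = R • WithLp.toLp 2 (w, 0) := by
        rw [← WithLp.toLp_smul, Prod.smul_mk, smul_zero]
      rw [h3, map_smul, smul_eq_mul] at h2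
      exact (mul_eq_zero.1 h2).resolve_left hR
    · rw [hp, Real.cos_zero, Real.sin_zero, one_smul, zero_smul, add_zero]

/-- If the spherical array were `C^r`, then so would be its profile `y ↦ ∫₀^|y|`. -/
theorem contDiffAt_scalingIntegral_abs_of_hypersurface {n k : ℕ}
    (hk : 2 ≤ k) (hkn : k < n) {r : WithTop ℕ∞} (hr0 : r ≠ 0)
    (h : IsHypersurfaceOfClass r (archimedeanSphericalArray n k)) :
    ContDiffAt ℝ r (fun y : ℝ => scalingIntegral k |y|) 0 := by
  have : Nonempty (Fin (n - k)) := ⟨⟨0, by omega⟩⟩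
  have : Nonempty (Fin k) := ⟨⟨0, by omega⟩⟩
  obtain ⟨e, he⟩ := (NormedSpace.sphere_nonempty
    (x := (0 : EuclideanSpace ℝ (Fin (n - k))))).2 zero_le_one
  obtain ⟨u, hu⟩ := (NormedSpace.sphere_nonempty
    (x := (0 : EuclideanSpace ℝ (Fin k)))).2 zero_le_one
  rw [mem_sphere_zero_iff_norm] at he hu
  have hM := archimedeanRadius_pos hk
  have hp : WithLp.toLp 2 (archimedeanRadius k • e, 0) ∈ archimedeanSphericalArray n k := by
    simpa [scalingIntegral_zero] using toLp_smul_mem_archimedeanSphericalArray hk hkn he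
      (x := (0 : EuclideanSpace ℝ (Fin k))) (by simp)
  obtain ⟨U, hU, hpU, F, hF, hF0, hSU⟩ := h _ hp
  have hFp := hF.contDiffAt (hU.mem_nhds hpU)
  have hzero {z} (hz : z ∈ archimedeanSphericalArray n k) (hzU : z ∈ U) : F z = 0 :=
    ((Set.ext_iff.1 hSU z).1 ⟨hz, hzU⟩).2
  have hgS (e : EuclideanSpace ℝ (Fin (n - k))) (he : ‖e‖ = 1) :
      ∀ᶠ x : EuclideanSpace ℝ (Fin k) in 𝓝 0, WithLp.toLp 2
        ((archimedeanRadius k - scalingIntegral k ‖x‖) • e, x) ∈ archimedeanSphericalArray n k := by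
    filter_upwards [Metric.closedBall_mem_nhds 0 one_pos] with x hx
      using toLp_smul_mem_archimedeanSphericalArray hk hkn he (mem_closedBall_zero_iff.1 hx)
  have hrad := fderiv_radial_ne_zero (hasFDerivAt_scalingIntegral_norm_zero hk)
    (by rw [norm_zero, scalingIntegral_zero]) hM.ne'
    hgS he rfl (hFp.differentiableAt hr0) hF0
    ((hU.eventually_mem hpU).mono fun z hzU hz => hzero hz hzU)
  -- The plane of the points `(s e, y u)`, in which the array is the curve `s = M - G |y|` near `(y,
  -- s) = (0, M)`.
  let ι : ℝ × ℝ →L[ℝ] WithLp 2 (EuclideanSpace ℝ (Fin (n - k)) × EuclideanSpace ℝ (Fin k)) :=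
    (WithLp.prodContinuousLinearEquiv 2 ℝ _ _).symm.toContinuousLinearMap.comp
      (((ContinuousLinearMap.snd ℝ ℝ ℝ).smulRight e).prod
        ((ContinuousLinearMap.fst ℝ ℝ ℝ).smulRight u))
  have hι (y s : ℝ) : ι (y, s) = WithLp.toLp 2 (s • e, y • u) := rfl
  have hι0 : ι (0, archimedeanRadius k) = WithLp.toLp 2 (archimedeanRadius k • e, 0) := by
    rw [hι, zero_smul]
  rw [← hι0] at hFp hrad hpU hp
  have hΦ : ContDiffAt ℝ r (fun v => F (ι v)) (0, archimedeanRadius k) :=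
    ContDiffAt.comp (g := F) _ hFp ι.contDiff.contDiffAt
  have hd : fderiv ℝ (fun v => F (ι v)) (0, archimedeanRadius k) =
      (fderiv ℝ F (ι (0, archimedeanRadius k))).comp ι :=
    (HasFDerivAt.comp (g := F) _ (hFp.differentiableAt hr0).hasFDerivAt ι.hasFDerivAt).fderiv
  -- The partial derivative in `s` is `dF (e, 0)`, nonzero by `hrad`.
  have hinv : (fderiv ℝ (fun v => F (ι v)) (0, archimedeanRadius k) ∘L
      .inr ℝ ℝ ℝ).IsInvertible := by
    refine ⟨ContinuousLinearEquiv.unitsEquivAut ℝ (Units.mk0 _ hrad), ?_⟩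
    ext
    rw [hd]
    simp [hι]
  have hev := hΦ.eventually_apply_eq_iff_implicitFunction hr0 hinv
  have hψ := hΦ.contDiffAt_implicitFunction hr0 hinv
  set ψ := hΦ.implicitFunction hr0 hinv
  have hG : Tendsto (fun y : ℝ => scalingIntegral k |y|) (𝓝 0) (𝓝 0) := by
    have h1 : Tendsto (fun y : ℝ => |y|) (𝓝 0) (𝓝 0) := by
      simpa using continuous_abs.tendsto (0 : ℝ)
    have h2 := (analyticAt_scalingIntegral hk (y := 0) (by simp)).continuousAt.tendsto
    rw [scalingIntegral_zero] at h2
    exact h2.comp h1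
  have hcurve : Tendsto (fun y : ℝ => (y, archimedeanRadius k - scalingIntegral k |y|)) (𝓝 0)
      (𝓝 (0, archimedeanRadius k)) := by
    refine tendsto_id.prodMk_nhds ?_
    simpa using hG.const_sub (archimedeanRadius k)
  have hUev := (ι.continuous.tendsto _).eventually (hU.eventually_mem hpU)
  have heq : (fun y : ℝ => scalingIntegral k |y|) =ᶠ[𝓝 0] fun y => archimedeanRadius k - ψ y := by
    filter_upwards [hcurve.eventually hev, hcurve.eventually hUev,
      Metric.closedBall_mem_nhds (0 : ℝ) one_pos] with y h1 h2 h3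
    have h4 : ‖y • u‖ = |y| := by rw [norm_smul, hu, mul_one, Real.norm_eq_abs]
    have h5 := toLp_smul_mem_archimedeanSphericalArray hk hkn he (x := y • u)
      (by rw [h4]; simpa using h3)
    rw [h4, ← hι] at h5
    have h6 := h1.1 (by rw [hzero h5 h2, hzero hp hpU])
    linarith
  exact (contDiffAt_const.sub hψ).congr_of_eventuallyEq heq

/-- Dividing by `H (y ^ 2)`, which is smooth and nonzero near `0`, would make `|y| ^ k` of class
`C^k`. -/
theorem not_contDiffAt_scalingIntegral_abs {k : ℕ} (hk : 2 ≤ k) (hodd : Odd k) :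
    ¬ ContDiffAt ℝ k (fun y : ℝ => scalingIntegral k |y|) 0 := by
  intro h
  obtain ⟨H, hH, hH0, hev⟩ := exists_scalingIntegral_eq_pow_mul hk
  have hsq : Tendsto (fun y : ℝ => y ^ 2) (𝓝 0) (𝓝 0) := by
    simpa using (continuous_pow 2).tendsto (0 : ℝ)
  have habs : Tendsto (fun y : ℝ => |y|) (𝓝 0) (𝓝 0) := by
    simpa using continuous_abs.tendsto (0 : ℝ)
  have h1 : ContDiffAt ℝ k (fun y : ℝ => H (y ^ 2)) 0 := by
    refine ContDiffAt.comp (g := H) 0 ?_ (contDiffAt_id.pow 2)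
    simpa using (contDiffAt_omega_iff_analyticAt.2 hH).of_le le_top
  refine not_contDiffAt_abs_pow hodd ((h.div h1 (by simpa using hH0)).congr_of_eventuallyEq ?_)
  filter_upwards [habs.eventually hev, hsq.eventually (hH.continuousAt.eventually_ne hH0)]
    with y h2 h3
  rw [Pi.div_apply, h2, sq_abs]
  field_simp

theorem theorem3 (n k : ℕ) (hk : 2 ≤ k) (hkn : k < n) :
    (Even k → IsHypersurfaceOfClass ω (archimedeanSphericalArray n k)) ∧
    (Odd k → IsHypersurfaceOfClass ((k - 1 : ℕ) : WithTop ℕ∞) (archimedeanSphericalArray n k) ∧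
      ¬ IsHypersurfaceOfClass ((k : ℕ) : WithTop ℕ∞) (archimedeanSphericalArray n k)) := by
  refine ⟨fun heven => ?_, fun hodd => ⟨?_, fun h => ?_⟩⟩
  · obtain ⟨m, hm⟩ := heven.two_dvd
    refine isHypersurfaceOfClass_archimedeanSphericalArray hk hkn (by simp) (by simp) ?_
    simp only [hm, pow_mul]
    exact (contDiff_norm_sq ℝ).contDiffAt.pow m
  · refine isHypersurfaceOfClass_archimedeanSphericalArray hk hkn (by simp) ?_ ?_
    · simp
      omega
    · have := (contDiff_norm_pow_succ (E := EuclideanSpace ℝ (Fin k)) (k - 1)).contDiffAt (x := 0)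
      rwa [Nat.sub_add_cancel (by omega)] at this
  · exact not_contDiffAt_scalingIntegral_abs hk hodd
      (contDiffAt_scalingIntegral_abs_of_hypersurface hk hkn (by simp; omega) h)
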